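/- Let $n\ge 2$, let $U\subseteq\mathbb R^n$ be a nonempty open set (Euclidean topology), let $f\in\mathbb R[x_1,\dots,x_n]$ have total degree $d$, and for each $c\in\mathbb R$ put $f_c:=f+c$. Let $F_c(X_0,\dots,X_n)$ be the homogenization of $f_c$, i.e. the polynomial obtained from $f_c$ by replacing $x_i$ with $X_i$ for $1\le i\le n$ and multiplying each monomial by the power of $X_0$ that brings its degree up to $\deg f_c$. Write $Z(f_c):=\{\alpha\in\mathbb R^n: f_c(\alpha)=0\}$. Suppose that for some $c_0\in\mathbb R$ the complex zero set $$\left\{\alpha\in\mathbb C^{n+1}:\ \frac{\partial F_{c_0}}{\partial X_0}(\alpha)=\cdots=\frac{\partial F_{c_0}}{\partial X_n}(\alpha)=0\right\}$$ is equal to $\{(0,\dots,0)\}$ or to $\emptyset$. Then there is a nonempty open set $B\subseteq\mathbb R$ such that for every $c\in B$ there is no nonzero polynomial $g\in\mathbb R[x_1,\dots,x_n]$ of total degree less than $d$ that vanishes at every point of $Z(f_c)\cap U$. -/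

import Mathlib

noncomputable section

namespace MvPolynomial

/-- The homogenization of `f(x₁, …, xₙ)`: each monomial of `f` is multiplied by the power of the new
variable `X₀` that brings its degree up to the total degree of `f`. The variable `xᵢ` with index
`i : Fin n` becomes the variable with index `i.succ`, and `X₀` has index `0 : Fin (n + 1)`. -/
def homogenization {n : ℕ} (f : MvPolynomial (Fin n) ℝ) : MvPolynomial (Fin (n + 1)) ℝ :=
  ∑ m ∈ f.support, monomial (Finsupp.cons (f.totalDegree - m.degree) m) (f.coeff m)

/-- The set of common zeros in `ℂ^(n+1)` of all the partial derivatives of `F`. -/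
def complexCriticalSet {n : ℕ} (F : MvPolynomial (Fin (n + 1)) ℝ) : Set (Fin (n + 1) → ℂ) :=
  {α | ∀ i : Fin (n + 1), aeval α (pderiv i F) = 0}

/-- The real zero set `Z(f)`, a subset of `ℝ^n`. -/
def realZeroSet {n : ℕ} (f : MvPolynomial (Fin n) ℝ) : Set (Fin n → ℝ) :=
  {α | eval α f = 0}

end MvPolynomial

end

/-!
The theorem is trivial when `f` is constant, so let `f` have positive degree `d`. The fibre
`f + c` has homogenization `F_c = F_{c₀} + (c - c₀) X₀ ^ d`, so its partial derivatives form a pencil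
of systems of homogeneous equations of degree `d - 1` in the parameter `c`. At `c = c₀` the system has
no complex solution outside the origin, and by elimination (`finite_setOf_pencil_zero`) the same holds
for all but finitely many `c`.

For such `c` the polynomial `f + c` is irreducible (`irreducible_of_complexCriticalSet_subset`): if
it were a product of two nonconstant polynomials, their homogenizations, which are forms in
`n + 1 ≥ 3` variables, would have a common zero outside the origin by Krull's height theorem
(`exists_common_zero_of_isHomogeneous`), and all partial derivatives of `F_c` would vanish there.

As `f` is nonconstant, it takes two distinct values at the ends of some segment parallel to a
coordinate axis inside a ball contained in `U`. The set `B` consists of those `c` for which `f + c` is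
negative at one end and positive at the other, without the finitely many exceptions. For `c ∈ B`,
the intermediate value theorem shows that the real zeros of `f + c` in `U` project onto a set with
interior in the remaining coordinates. A polynomial `g` vanishing on these zeros and not
divisible by the irreducible polynomial `f + c` would yield a nonzero eliminant vanishing on this
set, which is impossible (`dvd_of_sign_change`). Hence `f + c` divides `g`, and `g` has degree at
least `d`.
-/

namespace MvPolynomial

/-! ### Pencils of systems of homogeneous equations -/

section Pencil

variable {K σ ι : Type*} [Field K] [IsAlgClosed K] [Finite σ] [Fintype ι]

theorem homogeneousComponent_mul_of_isHomogeneous {R σ : Type*} [CommSemiring R] {e : ℕ}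
    {P : MvPolynomial σ R} (hP : P.IsHomogeneous e) (a : MvPolynomial σ R) (N : ℕ) :
    homogeneousComponent (N + e) (a * P) = homogeneousComponent N a * P := by
  conv_lhs => rw [← sum_homogeneousComponent a, Finset.sum_mul, map_sum]
  have key : ∀ i, homogeneousComponent (N + e) (homogeneousComponent i a * P) =
      if i = N then homogeneousComponent N a * P else 0 := by
    intro i
    rw [homogeneousComponent_of_mem (((homogeneousComponent_isHomogeneous i a).mul hP))]
    by_cases h : i = N
    · subst h; simp
    · rw [if_neg h, if_neg (by omega)]
  simp_rw [key, Finset.sum_ite_eq']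
  split_ifs with h
  · rfl
  · rw [homogeneousComponent_eq_zero _ _ (by simpa using h), zero_mul]

/-- A homogeneous Nullstellensatz: if forms of degree `e` have no common zero outside the origin,
then in some degree every form is a combination of them with homogeneous coefficients. -/
theorem exists_isHomogeneous_sum_mul {e : ℕ} (P : ι → MvPolynomial σ K)
    (hP : ∀ j, (P j).IsHomogeneous e)
    (hzero : ∀ α : σ → K, (∀ j, eval α (P j) = 0) → α = 0) :
    ∃ N : ℕ, ∀ v : MvPolynomial σ K, v.IsHomogeneous (N + e) →
      ∃ w : ι → MvPolynomial σ K, (∀ j, (w j).IsHomogeneous N) ∧ v = ∑ j, w j * P j := by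
  set I : Ideal (MvPolynomial σ K) := Ideal.span (Set.range P) with hI
  have hrad : idealOfVars σ K ≤ I.radical := by
    rw [← vanishingIdeal_zeroLocus_eq_radical (K := K), Ideal.span_le]
    rintro _ ⟨i, rfl⟩ α hα
    have : α = 0 := hzero α fun j => by
      simpa [aeval_eq_eval] using hα (P j) (Ideal.subset_span ⟨j, rfl⟩)
    simp [this]
  obtain ⟨N, hN⟩ := Ideal.exists_radical_pow_le_of_fg I (IsNoetherian.noetherian _)
  refine ⟨N, fun v hv => ?_⟩
  have hvI : v ∈ I := by
    refine hN (Ideal.pow_right_mono hrad N ?_)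
    rw [mem_pow_idealOfVars_iff]
    intro x hx
    by_contra hlt
    exact (mem_support_iff.1 hx) (hv.coeff_eq_zero (by omega))
  obtain ⟨a, ha⟩ := (Submodule.mem_span_range_iff_exists_fun _).1 hvI
  refine ⟨fun j => homogeneousComponent N (a j),
    fun j => homogeneousComponent_isHomogeneous N (a j), ?_⟩
  rw [← homogeneousComponent_eq_self hv, ← ha, map_sum]
  exact Finset.sum_congr rfl fun j _ => homogeneousComponent_mul_of_isHomogeneous (hP j) _ _

/-- Elimination for pencils: if the forms `P j` have no common zero outside the origin, the same
holds for the forms `P j + t • Q j`, except for finitely many values of `t`. For a nontrivial common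
zero `α` of the latter, evaluation at `α` is an eigenvector, with eigenvalue `-t⁻¹`, of the transpose
of an endomorphism (independent of `t` and `α`) of a space of forms. -/
theorem finite_setOf_pencil_zero {e : ℕ} (P Q : ι → MvPolynomial σ K)
    (hP : ∀ j, (P j).IsHomogeneous e) (hQ : ∀ j, (Q j).IsHomogeneous e)
    (hzero : ∀ α : σ → K, (∀ j, eval α (P j) = 0) → α = 0) :
    {t : K | ∃ α : σ → K, α ≠ 0 ∧ ∀ j, eval α (P j) + t * eval α (Q j) = 0}.Finite := by
  obtain ⟨N, hN⟩ := exists_isHomogeneous_sum_mul P hP hzero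
  let V := homogeneousSubmodule σ K (N + e)
  let W := homogeneousSubmodule σ K N
  have hfin : Module.Finite K V := Module.Finite.iff_fg.2 (homogeneousSubmodule_fg σ K (N + e))
  -- For a family `R` of forms, `Φ R` sends coefficients `w` to `∑ w j * R j`.
  let Φ (R : ι → MvPolynomial σ K) (hR : ∀ j, (R j).IsHomogeneous e) : (ι → W) →ₗ[K] V :=
    { toFun := fun w => ⟨∑ j, (w j : MvPolynomial σ K) * R j,
        IsHomogeneous.sum _ _ _ fun j _ => IsHomogeneous.mul (w j).2 (hR j)⟩
      map_add' := fun w w' => by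
        ext1; simp [add_mul, Finset.sum_add_distrib]
      map_smul' := fun c w => by
        ext1; simp [Finset.smul_sum] }
  have hsurj : Function.Surjective (Φ P hP) := by
    rintro ⟨v, hv⟩
    obtain ⟨w, hw, rfl⟩ := hN v hv
    exact ⟨fun j => ⟨w j, hw j⟩, rfl⟩
  obtain ⟨S, hS⟩ := (Φ P hP).exists_rightInverse_of_surjective (LinearMap.range_eq_top.2 hsurj)
  let A : Module.End K (Module.Dual K V) := ((Φ Q hQ) ∘ₗ S).dualMap
  refine (A.finite_hasEigenvalue.image fun μ => -μ⁻¹).subset ?_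
  rintro t ⟨α, hα, ht⟩
  let φ : Module.Dual K V := (aeval (R := K) α).toLinearMap ∘ₗ V.subtype
  have hφ0 : φ ≠ 0 := by
    obtain ⟨i, hi⟩ := Function.ne_iff.1 hα
    intro h
    have h1 := LinearMap.congr_fun h ⟨X i ^ (N + e), isHomogeneous_X_pow i _⟩
    simp only [φ, LinearMap.comp_apply, Submodule.subtype_apply, AlgHom.toLinearMap_apply, map_pow,
      aeval_X, LinearMap.zero_apply] at h1
    exact hi (eq_zero_of_pow_eq_zero h1)
  have hΦ (R) (hR) (w : ι → W) :
      φ (Φ R hR w) = ∑ j, eval α (w j : MvPolynomial σ K) * eval α (R j) := by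
    simp [φ, Φ, aeval_eq_eval]
  have hφA : φ = -t • A φ := by
    ext v
    have hv : v = Φ P hP (S v) := (LinearMap.congr_fun hS v).symm
    have hA : A φ v = φ (Φ Q hQ (S v)) := rfl
    rw [LinearMap.smul_apply, hA]
    conv_lhs => rw [hv]
    rw [hΦ _ hP, hΦ _ hQ, smul_eq_mul, Finset.mul_sum]
    refine Finset.sum_congr rfl fun j _ => ?_
    linear_combination (eval α (S v j : MvPolynomial σ K)) * ht j
  have ht0 : t ≠ 0 := by
    rintro rfl
    exact hφ0 (by rw [hφA]; simp)
  refine ⟨-t⁻¹, Module.End.hasEigenvalue_of_hasEigenvector (x := φ) ⟨?_, hφ0⟩, by simp⟩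
  rw [Module.End.mem_eigenspace_iff]
  conv_rhs => rw [hφA]
  rw [smul_smul, neg_mul_neg, inv_mul_cancel₀ ht0, one_smul]

end Pencil

/-! ### Two forms in at least three variables -/

section CommonZero

variable {K σ : Type*} [Field K]

/-- The coordinate subspace ideals `(X i : i ∈ S)` are prime and strictly increasing in `S`, so
there is a chain of primes of length `card σ` below the ideal of the origin. -/
theorem card_le_height_vanishingIdeal_zero [Fintype σ] :
    (Fintype.card σ : ℕ∞) ≤
      (vanishingIdeal K {(0 : σ → K)} : Ideal (MvPolynomial σ K)).height := by
  classical
  let ψ (S : Finset σ) : MvPolynomial σ K →ₐ[K] MvPolynomial σ K :=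
    aeval fun i => if i ∈ S then 0 else X i
  have hprime (S : Finset σ) : (RingHom.ker (ψ S)).IsPrime := RingHom.ker_isPrime _
  have hcard (S : Finset σ) : (S.card : ℕ∞) ≤ (RingHom.ker (ψ S)).height := by
    induction S using Finset.induction_on with
    | empty => simp
    | insert i S hi ih =>
      have hcomp : (ψ (insert i S)).comp (ψ S) = ψ (insert i S) := by
        ext1 j
        by_cases hj : j ∈ S <;> simp [ψ, hj]
      have hlt : RingHom.ker (ψ S) < RingHom.ker (ψ (insert i S)) := by
        refine SetLike.lt_iff_le_and_exists.2 ⟨fun p hp => ?_, X i, ?_, ?_⟩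
        · rw [RingHom.mem_ker] at hp ⊢
          rw [← hcomp, AlgHom.comp_apply, hp, map_zero]
        · simp [RingHom.mem_ker, ψ]
        · simp [RingHom.mem_ker, ψ, hi]
      rw [Finset.card_insert_of_notMem hi]
      push_cast
      exact (add_le_add_left ih 1).trans (Ideal.height_add_one_le_of_lt_of_isPrime hlt)
  refine (hcard Finset.univ).trans (Ideal.height_mono fun p hp => ?_)
  rw [mem_vanishingIdeal_singleton_iff]
  have h0 : (aeval (0 : σ → K)).comp (ψ Finset.univ) = aeval (0 : σ → K) := by
    ext1 j; simp [ψ]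
  rw [← h0, AlgHom.comp_apply, RingHom.mem_ker.1 hp, map_zero]

/-- Two hypersurfaces in a projective space of dimension at least two meet: otherwise the ideal of
the origin would be a minimal prime over two elements, contradicting Krull's height theorem. -/
theorem exists_common_zero_of_isHomogeneous [IsAlgClosed K] [Fintype σ]
    (hσ : 3 ≤ Fintype.card σ) {a b : ℕ} {G H : MvPolynomial σ K} (hG : G.IsHomogeneous a)
    (hH : H.IsHomogeneous b) (ha : a ≠ 0) (hb : b ≠ 0) :
    ∃ α : σ → K, α ≠ 0 ∧ eval α G = 0 ∧ eval α H = 0 := by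
  by_contra! hcon
  have hzero {d : ℕ} {F : MvPolynomial σ K} (hF : F.IsHomogeneous d) (hd : d ≠ 0) :
      eval 0 F = 0 := by
    rw [eval_zero, constantCoeff_eq]
    exact hF.coeff_eq_zero (by simpa using hd.symm)
  have hlocus : zeroLocus K (Ideal.span {G, H}) = {(0 : σ → K)} := by
    ext α
    rw [zeroLocus_span]
    simp only [Set.mem_insert_iff, Set.mem_singleton_iff, forall_eq_or_imp, forall_eq,
      Set.mem_ofPred_eq, aeval_eq_eval]
    refine ⟨fun h => ?_, ?_⟩
    · by_contra hα
      exact hcon α hα (by simpa using h.1) (by simpa using h.2)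
    · rintro rfl
      exact ⟨by simpa using hzero hG ha, by simpa using hzero hH hb⟩
  have hrad := vanishingIdeal_zeroLocus_eq_radical (k := K) (K := K) (Ideal.span {G, H})
  rw [hlocus] at hrad
  have hmin : vanishingIdeal K {(0 : σ → K)} ∈ (Ideal.span {G, H}).minimalPrimes := by
    rw [← Ideal.radical_minimalPrimes, ← hrad, Ideal.minimalPrimes_eq_subsingleton_self]
    rfl
  have h1 := Ideal.height_le_card_of_mem_minimalPrimes_span (Set.toFinite _) hmin
  have h2 : ((({G, H} : Set (MvPolynomial σ K)).ncard : ℕ) : ℕ∞) ≤ 2 := by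
    exact_mod_cast (Set.ncard_insert_le G {H}).trans (by simp)
  have h3 := (card_le_height_vanishingIdeal_zero (K := K) (σ := σ)).trans (h1.trans h2)
  have h4 : Fintype.card σ ≤ 2 := by exact_mod_cast h3
  omega

end CommonZero

/-! ### Homogenization -/

section Homogenization

variable {n : ℕ}

theorem IsHomogeneous.eval_smul {R σ : Type*} [CommSemiring R] {P : MvPolynomial σ R} {d : ℕ}
    (hP : P.IsHomogeneous d) (c : R) (y : σ → R) : eval (c • y) P = c ^ d * eval y P := by
  rw [eval_eq, eval_eq, Finset.mul_sum]
  refine Finset.sum_congr rfl fun m hm => ?_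
  rw [hP.degree_eq_sum_deg_support hm]
  simp only [Pi.smul_apply, smul_eq_mul, mul_pow, Finset.prod_mul_distrib, Finset.prod_pow_eq_pow_sum]
  rw [mul_left_comm]

/-- A form is determined by its degree and its dehomogenization. -/
theorem IsHomogeneous.eq_of_eval_cons_one {R : Type*} [Field R] [Infinite R]
    {P Q : MvPolynomial (Fin (n + 1)) R} {d : ℕ}
    (hP : P.IsHomogeneous d) (hQ : Q.IsHomogeneous d)
    (h : ∀ x : Fin n → R, eval (Fin.cons 1 x : Fin (n + 1) → R) P =
      eval (Fin.cons 1 x : Fin (n + 1) → R) Q) : P = Q := by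
  have key : X 0 * P = X 0 * Q := by
    refine MvPolynomial.funext fun y => ?_
    simp only [map_mul, eval_X]
    by_cases hy : y 0 = 0
    · simp [hy]
    · have hy' : y = y 0 • (Fin.cons 1 ((y 0)⁻¹ • Fin.tail y) : Fin (n + 1) → R) := by
        funext i
        refine Fin.cases (by simp) (fun j => ?_) i
        simp [Fin.tail, hy]
      rw [hy', hP.eval_smul, hQ.eval_smul, h]
  exact mul_left_cancel₀ (X_ne_zero 0) key

theorem isHomogeneous_homogenization (f : MvPolynomial (Fin n) ℝ) :
    f.homogenization.IsHomogeneous f.totalDegree := by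
  refine IsHomogeneous.sum _ _ _ fun m hm => isHomogeneous_monomial _ ?_
  have h := le_totalDegree hm
  have h2 : (m.sum fun _ e => e) = m.degree := rfl
  rw [Finsupp.degree_eq_sum, Fin.sum_univ_succ]
  simp only [Finsupp.cons_zero, Finsupp.cons_succ, ← Finsupp.degree_eq_sum]
  omega

theorem eval_cons_one_homogenization (f : MvPolynomial (Fin n) ℝ) (x : Fin n → ℝ) :
    eval (Fin.cons 1 x : Fin (n + 1) → ℝ) f.homogenization = eval x f := by
  rw [homogenization, map_sum, eval_eq']
  refine Finset.sum_congr rfl fun m _ => ?_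
  rw [eval_monomial, Finsupp.prod_fintype _ _ (by simp), Fin.prod_univ_succ]
  simp

theorem homogenization_eq {f : MvPolynomial (Fin n) ℝ} {P : MvPolynomial (Fin (n + 1)) ℝ} {d : ℕ}
    (hP : P.IsHomogeneous d) (hd : f.totalDegree = d)
    (h : ∀ x : Fin n → ℝ, eval (Fin.cons 1 x : Fin (n + 1) → ℝ) P = eval x f) :
    f.homogenization = P := by
  subst hd
  exact (isHomogeneous_homogenization f).eq_of_eval_cons_one hP fun x => by
    rw [eval_cons_one_homogenization, h]

theorem homogenization_mul {g h : MvPolynomial (Fin n) ℝ} (hg : g ≠ 0) (hh : h ≠ 0) :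
    (g * h).homogenization = g.homogenization * h.homogenization :=
  homogenization_eq ((isHomogeneous_homogenization g).mul (isHomogeneous_homogenization h))
    (totalDegree_mul_of_isDomain hg hh) fun x => by simp [eval_cons_one_homogenization]

theorem totalDegree_add_C {R σ : Type*} [CommRing R] {f : MvPolynomial σ R} (hf : f.totalDegree ≠ 0)
    (c : R) : (f + C c).totalDegree = f.totalDegree :=
  totalDegree_add_eq_left_of_totalDegree_lt (by rw [totalDegree_C]; omega)

theorem homogenization_add_C {f : MvPolynomial (Fin n) ℝ} (hf : f.totalDegree ≠ 0) (c : ℝ) :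
    (f + C c).homogenization = f.homogenization + C c * X 0 ^ f.totalDegree :=
  homogenization_eq ((isHomogeneous_homogenization f).add (isHomogeneous_C_mul_X_pow c 0 _))
    (totalDegree_add_C hf c) fun x => by simp [eval_cons_one_homogenization]

/-! ### Smoothness and irreducibility of the fibres -/

/-- A polynomial whose projective closure is smooth is irreducible when there are at least two
variables: the homogenizations of two nonconstant factors would have a common zero, at which all
partial derivatives of the product vanish. -/
theorem irreducible_of_complexCriticalSet_subset (hn : 2 ≤ n) {f : MvPolynomial (Fin n) ℝ}
    (hf : f.totalDegree ≠ 0) (hcrit : f.homogenization.complexCriticalSet ⊆ {0}) :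
    Irreducible f := by
  refine ⟨fun hu => hf (isUnit_iff_totalDegree_of_isReduced.1 hu).2, fun g h hgh => ?_⟩
  have hf0 : f ≠ 0 := by rintro rfl; simp at hf
  have hg0 : g ≠ 0 := by rintro rfl; simp [hgh] at hf0
  have hh0 : h ≠ 0 := by rintro rfl; simp [hgh] at hf0
  have unit_of {p : MvPolynomial (Fin n) ℝ} (hp0 : p ≠ 0) (hp : p.totalDegree = 0) : IsUnit p := by
    rw [totalDegree_eq_zero_iff_eq_C] at hp
    rw [hp] at hp0 ⊢
    exact (IsUnit.mk0 _ fun h0 => hp0 (by rw [h0, map_zero])).map C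
  by_contra! hcon
  have hg : g.totalDegree ≠ 0 := fun h0 => hcon.1 (unit_of hg0 h0)
  have hh : h.totalDegree ≠ 0 := fun h0 => hcon.2 (unit_of hh0 h0)
  obtain ⟨α, hα, hGα, hHα⟩ := exists_common_zero_of_isHomogeneous (K := ℂ) (σ := Fin (n + 1))
    (by simpa using hn)
    ((isHomogeneous_homogenization g).map (algebraMap ℝ ℂ))
    ((isHomogeneous_homogenization h).map (algebraMap ℝ ℂ)) hg hh
  rw [eval_map, ← aeval_def] at hGα hHα
  refine hα (hcrit fun i => ?_)
  rw [hgh, homogenization_mul hg0 hh0, Derivation.leibniz]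
  simp [hGα, hHα]

/-- Smoothness of the projective closure of one fibre of `f` spreads to all but finitely many. -/
theorem finite_setOf_not_complexCriticalSet_subset {f : MvPolynomial (Fin n) ℝ}
    (hf : f.totalDegree ≠ 0) {c₀ : ℝ}
    (h₀ : (f + C c₀).homogenization.complexCriticalSet ⊆ {0}) :
    {c : ℝ | ¬ (f + C c).homogenization.complexCriticalSet ⊆ {0}}.Finite := by
  let D (p : MvPolynomial (Fin (n + 1)) ℝ) (j : Fin (n + 1)) : MvPolynomial (Fin (n + 1)) ℂ :=
    map (algebraMap ℝ ℂ) (pderiv j p)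
  have heval (p) (j) (α : Fin (n + 1) → ℂ) : eval α (D p j) = aeval α (pderiv j p) := by
    rw [eval_map, ← aeval_def]
  have hfin := finite_setOf_pencil_zero (K := ℂ) (e := f.totalDegree - 1)
    (D (f + C c₀).homogenization) (D (X 0 ^ f.totalDegree))
    (fun j => by
      have := isHomogeneous_homogenization (f + C c₀)
      rw [totalDegree_add_C hf] at this
      exact this.pderiv.map _)
    (fun j => ((isHomogeneous_X_pow 0 _).pderiv).map _)
    (fun α hα => h₀ fun i => by rw [← heval]; exact hα i)
  refine (hfin.preimage (f := fun c : ℝ => ((c - c₀ : ℝ) : ℂ)) ?_).subset ?_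
  · exact fun a _ b _ hab => by simpa using hab
  · intro c hc
    obtain ⟨α, hα, hα0⟩ := Set.not_subset.1 hc
    refine ⟨α, hα0, fun j => ?_⟩
    have hj := hα j
    have hpencil : (f + C c).homogenization =
        (f + C c₀).homogenization + C (c - c₀) * X 0 ^ f.totalDegree := by
      rw [homogenization_add_C hf, homogenization_add_C hf, C_sub]
      ring
    rw [hpencil, map_add, pderiv_C_mul, map_add, map_mul, aeval_C] at hj
    rw [heval, heval, ← hj]
    rfl

end Homogenization

/-! ### Real zeros along a sign change -/

section SignChange

variable {σ : Type*}

/-- Elimination of one variable: if `q` is irreducible and does not divide `g`, the ideal `(q, g)`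
contains a nonzero polynomial not involving the variable `i`. -/
theorem exists_rename_mem_span_pair {K : Type*} [Field K] (i : σ) {q g : MvPolynomial σ K}
    (hq : Irreducible q) (hg : ¬ q ∣ g) :
    ∃ r : MvPolynomial {j // j ≠ i} K, r ≠ 0 ∧
      ∃ s t, rename Subtype.val r = s * q + t * g := by
  classical
  let E : MvPolynomial σ K ≃ₐ[K] Polynomial (MvPolynomial {j // j ≠ i} K) :=
    (renameEquiv K (Equiv.optionSubtypeNe i).symm).trans (optionEquivLeft K _)
  have hE (r : MvPolynomial {j // j ≠ i} K) : E (rename Subtype.val r) = Polynomial.C r := by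
    have : E.toAlgHom.comp (rename Subtype.val) =
        (Polynomial.CAlgHom (R := K) (A := MvPolynomial {j // j ≠ i} K)) := by
      ext1 j
      simp [E, Equiv.optionSubtypeNe_symm_of_ne j.2]
    exact DFunLike.congr_fun this r
  have hprime : Prime (E q) := ((MulEquiv.irreducible_iff E.toMulEquiv).2 hq).prime
  have : Fact (Irreducible (E q)) := ⟨hprime.irreducible⟩
  have hdom : IsDomain (AdjoinRoot (E q)) := by
    have := (Ideal.span_singleton_prime hprime.ne_zero).2 hprime
    exact Ideal.Quotient.isDomain _
  have hroot : IsAlgebraic (MvPolynomial {j // j ≠ i} K) (AdjoinRoot.root (E q)) :=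
    ⟨E q, hprime.ne_zero, by rw [AdjoinRoot.aeval_eq, AdjoinRoot.mk_self]⟩
  have halg : IsAlgebraic (MvPolynomial {j // j ≠ i} K) (AdjoinRoot.mk (E q) (E g)) := by
    rw [← AdjoinRoot.aeval_eq]
    exact Algebra.adjoin_le (S := Subalgebra.algebraicClosure _ _)
      (Set.singleton_subset_iff.2 hroot) (Polynomial.aeval_mem_adjoin_singleton _ _)
  have hne : AdjoinRoot.mk (E q) (E g) ≠ 0 := by
    rw [Ne, AdjoinRoot.mk_eq_zero]
    exact fun h => hg ((map_dvd_iff E).1 h)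
  obtain ⟨r, hr, s, hs⟩ := halg.exists_nonzero_dvd (mem_nonZeroDivisors_of_ne_zero hne)
  obtain ⟨t, rfl⟩ := AdjoinRoot.mk_surjective s
  rw [AdjoinRoot.algebraMap_eq, ← AdjoinRoot.mk_C, ← map_mul, AdjoinRoot.mk_eq_mk] at hs
  obtain ⟨w, hw⟩ := hs
  refine ⟨r, hr, E.symm w, E.symm t, E.injective ?_⟩
  rw [hE, map_add, map_mul, map_mul, E.apply_symm_apply, E.apply_symm_apply]
  linear_combination hw

/-- If an irreducible `q` changes sign along a coordinate segment inside a ball, then every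
polynomial vanishing on the zeros of `q` in the ball is a multiple of `q`: by the intermediate value
theorem, their projection to the remaining coordinates has nonempty interior, so an eliminant
of `q` and the other polynomial would have to vanish. -/
theorem dvd_of_sign_change [Fintype σ] [DecidableEq σ] {q g : MvPolynomial σ ℝ}
    (hq : Irreducible q) {p x : σ → ℝ} {ε : ℝ} {i : σ} {a b : ℝ}
    (hx : x ∈ Metric.ball p ε) (ha : a ∈ Metric.ball (p i) ε) (hb : b ∈ Metric.ball (p i) ε)
    (hqa : eval (Function.update x i a) q < 0) (hqb : 0 < eval (Function.update x i b) q)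
    (hg : ∀ y ∈ Metric.ball p ε, eval y q = 0 → eval y g = 0) : q ∣ g := by
  by_contra hdvd
  obtain ⟨r, hr, s, t, hst⟩ := exists_rename_mem_span_pair i hq hdvd
  have hε : 0 < ε := Metric.pos_of_mem_ball hx
  have hcont (c : ℝ) : Continuous fun y : σ → ℝ => eval (Function.update y i c) q :=
    (MvPolynomial.continuous_eval q).comp (continuous_id.update i continuous_const)
  have hev : ∀ᶠ y in nhds x, y ∈ Metric.ball p ε ∧
      eval (Function.update y i a) q < 0 ∧ 0 < eval (Function.update y i b) q :=
    Filter.Eventually.and (Metric.isOpen_ball.mem_nhds hx)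
      (((hcont a).continuousAt.eventually_lt continuousAt_const hqa).and
        (continuousAt_const.eventually_lt (hcont b).continuousAt hqb))
  obtain ⟨δ, hδ, hball⟩ := Metric.eventually_nhds_iff_ball.1 hev
  refine hr ((rename_injective _ Subtype.val_injective) ?_)
  rw [map_zero]
  refine funext_set (fun j => Metric.ball (x j) δ)
    (fun j => by rw [Real.ball_eq_Ioo]; exact Set.Ioo_infinite (by linarith)) fun y hy => ?_
  rw [← ball_pi x hδ] at hy
  obtain ⟨hyp, hya, hyb⟩ := hball y hy
  obtain ⟨c, hc, hc0⟩ := intermediate_value_uIcc (a := a) (b := b)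
    (f := fun c => eval (Function.update y i c) q)
    ((MvPolynomial.continuous_eval q).comp (continuous_const.update i continuous_id)).continuousOn
    (Set.Icc_subset_uIcc ⟨hya.le, hyb.le⟩)
  replace hc0 : eval (Function.update y i c) q = 0 := hc0
  have hci : c ∈ Metric.ball (p i) ε :=
    (convex_ball (p i) ε).ordConnected.uIcc_subset ha hb hc
  have hmem : Function.update y i c ∈ Metric.ball p ε := by
    rw [ball_pi p hε] at hyp ⊢
    intro j _
    by_cases hj : j = i
    · subst hj; simpa using hci
    · simpa [hj] using hyp j trivial
  have hzero : eval (Function.update y i c) (rename Subtype.val r) = 0 := by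
    rw [hst, map_add, map_mul, map_mul, hc0, hg _ hmem hc0]
    ring
  rw [map_zero, ← hzero, eval_rename, eval_rename]
  congr 2
  funext j
  simp [Function.update_of_ne j.2]

/-- A nonconstant polynomial is nonconstant along some coordinate segment in any given ball. -/
theorem exists_update_eval_lt [Fintype σ] [DecidableEq σ] {f : MvPolynomial σ ℝ}
    (hf : f.totalDegree ≠ 0) (p : σ → ℝ) {ε : ℝ} (hε : 0 < ε) :
    ∃ x ∈ Metric.ball p ε, ∃ i, ∃ a ∈ Metric.ball (p i) ε, ∃ b ∈ Metric.ball (p i) ε,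
      eval (Function.update x i a) f < eval (Function.update x i b) f := by
  by_contra! hcon
  refine hf ?_
  suffices h : f = C (eval p f) by rw [h, totalDegree_C]
  refine funext_set (fun j => Metric.ball (p j) ε)
    (fun j => by rw [Real.ball_eq_Ioo]; exact Set.Ioo_infinite (by linarith)) fun y hy => ?_
  rw [eval_C]
  -- The coordinates of `p` are replaced by those of `y` one at a time.
  have key (s : Finset σ) : eval (s.piecewise y p) f = eval p f := by
    induction s using Finset.induction_on with
    | empty => simp
    | insert i s hi ih =>
      have hmem : s.piecewise y p ∈ Metric.ball p ε := by
        rw [ball_pi p hε]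
        intro j _
        by_cases hj : j ∈ s
        · simpa [hj] using hy j trivial
        · simpa [hj] using hε
      have hself : Function.update (s.piecewise y p) i (p i) = s.piecewise y p := by
        rw [Function.update_eq_self_iff]
        simp [hi]
      rw [Finset.piecewise_insert, ← ih]
      conv_rhs => rw [← hself]
      have hp := Metric.mem_ball_self (x := p i) hε
      exact le_antisymm (hcon _ hmem i _ hp _ (hy i trivial))
        (hcon _ hmem i _ (hy i trivial) _ hp)
  simpa using key Finset.univ

end SignChange

end MvPolynomial

/-! ### The generic fibre -/

open MvPolynomial in
theorem mainTheorem7 (n : ℕ) (hn : 2 ≤ n) (U : Set (Fin n → ℝ)) (hU : IsOpen U)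
    (hne : U.Nonempty) (f : MvPolynomial (Fin n) ℝ)
    (h : ∃ c₀ : ℝ,
      MvPolynomial.complexCriticalSet
          (MvPolynomial.homogenization (f + MvPolynomial.C c₀)) = {0} ∨
        MvPolynomial.complexCriticalSet
          (MvPolynomial.homogenization (f + MvPolynomial.C c₀)) = ∅) :
    ∃ B : Set ℝ, IsOpen B ∧ B.Nonempty ∧ ∀ c ∈ B,
      ¬ ∃ g : MvPolynomial (Fin n) ℝ, g ≠ 0 ∧ g.totalDegree < f.totalDegree ∧
        ∀ α ∈ MvPolynomial.realZeroSet (f + MvPolynomial.C c) ∩ U, MvPolynomial.eval α g = 0 := by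
  by_cases hf : f.totalDegree = 0
  · exact ⟨Set.univ, isOpen_univ, Set.univ_nonempty, fun c _ ⟨g, _, hg, _⟩ => by omega⟩
  obtain ⟨c₀, hc₀⟩ := h
  have h₀ : complexCriticalSet (homogenization (f + C c₀)) ⊆ {0} := by
    rcases hc₀ with h | h <;> simp [h]
  have hfin := finite_setOf_not_complexCriticalSet_subset hf h₀
  obtain ⟨p, hp⟩ := hne
  obtain ⟨ε, hε, hεU⟩ := Metric.isOpen_iff.1 hU p hp
  obtain ⟨x, hx, i, a, ha, b, hb, hab⟩ := exists_update_eval_lt hf p hε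
  refine ⟨Set.Ioo (-eval (Function.update x i b) f) (-eval (Function.update x i a) f) \
      {c : ℝ | ¬ (f + C c).homogenization.complexCriticalSet ⊆ {0}},
    isOpen_Ioo.sdiff hfin.isClosed, ?_, ?_⟩
  · exact ((Set.Ioo_infinite (by linarith)).sdiff hfin).nonempty
  · rintro c ⟨⟨hcb, hca⟩, hc⟩ ⟨g, hg0, hgdeg, hg⟩
    have hirr : Irreducible (f + C c) :=
      irreducible_of_complexCriticalSet_subset hn (by rwa [totalDegree_add_C hf]) (not_not.1 hc)
    have hdvd : f + C c ∣ g :=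
      dvd_of_sign_change hirr hx ha hb (by simp; linarith) (by simp; linarith)
        fun y hy hy0 => hg y ⟨hy0, hεU hy⟩
    have hle := totalDegree_le_of_dvd_of_isDomain hdvd hg0
    rw [totalDegree_add_C hf] at hle
    omega
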